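/- Let $k$ be an algebraically closed field and let $C$ and $B$ be finite dimensional $k$-algebras such that $B$ is a split extension of $C$ by a nilpotent bimodule $E$: there are $k$-algebra homomorphisms $\pi\colon B\to C$ and $\sigma\colon C\to B$ with $\pi\circ\sigma=1_C$, and the ideal $E=\ker\pi$ is nilpotent. All modules are finitely generated right modules. A $C$-module is regarded as a $B$-module through $\pi$; for a $B$-module $X$, $X_C$ denotes $X$ regarded as a $C$-module through $\sigma$; and $M\otimes_C B$ is formed through $\sigma$. For a finite dimensional algebra $A$ let $\tau_A=D\,\mathrm{Tr}$ be the Auslander--Reiten translation; an $A$-module $N$ is called $\tau_A$-rigid if $\mathrm{Hom}_A(N,\tau_A N)=0$. Let $M$ be a $\tau_C$-rigid $C$-module, and suppose that $M$, regarded as a $B$-module, is $\tau_B$-rigid. Let ${}^{\perp}(\tau_B M)$ be the torsion class of all $B$-modules $X$ with $\mathrm{Hom}_B(X,\tau_B M)=0$. Then $M\otimes_C B$ is $\mathrm{Ext}$-projective in ${}^{\perp}(\tau_B M)$, that is, $M\otimes_C B\in{}^{\perp}(\tau_B M)$ and $\mathrm{Ext}^1_B(M\otimes_C B,Y)=0$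 for all $Y\in{}^{\perp}(\tau_B M)$, if and only if $\mathrm{Hom}_C(M,(\tau_B M)_C)=0$. -/

import Mathlib

open CategoryTheory
open scoped TensorProduct

universe u

/-! Right `R`-modules are modules over `Rᵐᵒᵖ`: the element `m r` is `MulOpposite.op r • m`. -/

namespace TauRigid

noncomputable section

section ProjectiveCover

variable {R : Type u} [Ring R]

/-- `f : P → M` is a projective cover: `P` is projective, `f` is surjective, and `ker f` is
superfluous in `P`. -/
structure IsProjectiveCover {P M : Type u} [AddCommGroup P] [Module R P] [AddCommGroup M]
    [Module R M] (f : P →ₗ[R] M) : Prop where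
  projective : Module.Projective R P
  surjective : Function.Surjective f
  superfluous : ∀ N : Submodule R P, N ⊔ LinearMap.ker f = ⊤ → N = ⊤

/-- A minimal projective presentation `P₁ → P₀ → M → 0` of a module `M` by finitely generated
projective modules: `P₀ → M` and `P₁ → ker (P₀ → M)` are projective covers. -/
structure MinProjPres (M : ModuleCat.{u} R) where
  P₀ : ModuleCat.{u} R
  P₁ : ModuleCat.{u} R
  finite₀ : Module.Finite R P₀
  finite₁ : Module.Finite R P₁
  d₀ : P₀ →ₗ[R] M
  d₁ : P₁ →ₗ[R] P₀
  comp_eq_zero : ∀ x, d₀ (d₁ x) = 0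
  cover₀ : IsProjectiveCover d₀
  cover₁ : IsProjectiveCover
    (d₁.codRestrict (LinearMap.ker d₀) fun x => LinearMap.mem_ker.2 (comp_eq_zero x))

/-- A direct summand of a projective module is projective. -/
theorem projective_of_isCompl {P : Type u} [AddCommGroup P] [Module R P] [Module.Projective R P]
    {p q : Submodule R P} (h : IsCompl p q) : Module.Projective R p :=
  Module.Projective.of_split p.subtype (Submodule.projectionOnto p q h)
    (Submodule.projectionOnto_comp_subtype h)

/-- Over an artinian ring every finitely generated module has a projective cover. -/
theorem exists_projectiveCover [IsArtinianRing R] (M : Type u) [AddCommGroup M] [Module R M]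
    [Module.Finite R M] :
    ∃ (P : ModuleCat.{u} R) (f : P →ₗ[R] M), Module.Finite R P ∧ IsProjectiveCover f := by
  obtain ⟨n, F, hF⟩ := Module.Finite.exists_fin' R M
  let S : Set (Submodule R (Fin n → R)) :=
    {N | Module.Projective R N ∧ Submodule.map F N = ⊤}
  have hS : S.Nonempty := by
    refine ⟨⊤, Module.Projective.of_equiv (Submodule.topEquiv (R := R) (M := Fin n → R)).symm, ?_⟩
    rw [Submodule.map_top, LinearMap.range_eq_top.2 hF]
  obtain ⟨N, ⟨hNp, hNs⟩, hmin⟩ := WellFounded.has_min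
    (IsWellFounded.wf : WellFounded ((· < ·) : Submodule R (Fin n → R) → _ → Prop)) S hS
  have hfs : Function.Surjective (F.domRestrict N) := by
    intro m
    have : m ∈ Submodule.map F N := hNs ▸ Submodule.mem_top
    obtain ⟨x, hx, rfl⟩ := this
    exact ⟨⟨x, hx⟩, rfl⟩
  refine ⟨ModuleCat.of R N, F.domRestrict N, inferInstanceAs (Module.Finite R N), hNp, hfs, ?_⟩
  intro L hL
  let f : N →ₗ[R] M := F.domRestrict N
  change Submodule R N at L
  change L ⊔ LinearMap.ker f = ⊤ at hL
  have hLs : Function.Surjective (f.domRestrict L) := by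
    intro m
    obtain ⟨x, rfl⟩ := hfs m
    have hx : x ∈ L ⊔ LinearMap.ker f := hL ▸ Submodule.mem_top
    obtain ⟨y, hy, z, hz, rfl⟩ := Submodule.mem_sup.1 hx
    refine ⟨⟨y, hy⟩, ?_⟩
    have hz' : f z = 0 := hz
    change f y = f (y + z)
    rw [map_add, hz', add_zero]
  obtain ⟨g, hg⟩ := Module.projective_lifting_property (f.domRestrict L) f hLs
  let e : Module.End R N := L.subtype ∘ₗ g
  have hfe : ∀ x, f (e x) = f x := fun x => LinearMap.congr_fun hg x
  have hfek : ∀ (k : ℕ) x, f ((e ^ k) x) = f x := by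
    intro k
    induction k with
    | zero => intro x; rfl
    | succ k ih => intro x; rw [pow_succ, Module.End.mul_apply, ih, hfe]
  obtain ⟨k, hk⟩ := Filter.eventually_atTop.1 e.eventually_isCompl_ker_pow_range_pow
  have hc := (hk (k + 1) (Nat.le_succ k)).symm
  let Q : Submodule R N := LinearMap.range (e ^ (k + 1))
  have hQp : Module.Projective R Q := projective_of_isCompl hc
  have hQ' : Submodule.map N.subtype Q ∈ S := by
    refine ⟨Module.Projective.of_equiv (N.equivSubtypeMap Q), ?_⟩
    rw [eq_top_iff]
    rintro m -
    obtain ⟨x, rfl⟩ := hfs m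
    exact ⟨_, ⟨_, ⟨x, rfl⟩, rfl⟩, hfek (k + 1) x⟩
  have hQN : Submodule.map N.subtype Q = N := by
    have hle : Submodule.map N.subtype Q ≤ N := Submodule.map_subtype_le N Q
    by_contra hne
    exact hmin _ hQ' (lt_of_le_of_ne hle hne)
  rw [eq_top_iff]
  rintro x -
  have hx : (x : Fin n → R) ∈ Submodule.map N.subtype Q := hQN.symm ▸ x.2
  obtain ⟨y, ⟨w, rfl⟩, hy⟩ := hx
  have hyx : (e ^ (k + 1)) w = x := Subtype.ext hy
  rw [← hyx, pow_succ', Module.End.mul_apply]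
  exact (g ((e ^ k) w)).2

theorem nonempty_minProjPres [IsArtinianRing R] (M : ModuleCat.{u} R) [Module.Finite R M] :
    Nonempty (MinProjPres M) := by
  obtain ⟨P₀, d₀, h₀, c₀⟩ := exists_projectiveCover (R := R) M
  obtain ⟨P₁, e, h₁, c₁⟩ := exists_projectiveCover (R := R) (LinearMap.ker d₀)
  exact ⟨⟨P₀, P₁, h₀, h₁, d₀, (LinearMap.ker d₀).subtype ∘ₗ e, fun x => (e x).2, c₀, c₁⟩⟩

end ProjectiveCover

section Translate

/-- The dual `D T = Hom_k(T, k)` of a left `B`-module `T`. -/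
def DualModule (k T : Type u) [Field k] [AddCommGroup T] [Module k T] : Type u := T →ₗ[k] k

instance (k T : Type u) [Field k] [AddCommGroup T] [Module k T] :
    AddCommGroup (DualModule k T) := inferInstanceAs (AddCommGroup (T →ₗ[k] k))

/-- The right `B`-module structure `(φ b)(t) = φ (b t)` on the dual of a left `B`-module. -/
instance (k T B : Type u) [Field k] [Ring B] [Algebra k B] [AddCommGroup T] [Module k T]
    [Module B T] [IsScalarTower k B T] : Module Bᵐᵒᵖ (DualModule k T) where
  smul b φ := LinearMap.comp (R₁ := k) φ (Algebra.lsmul k k T b.unop : T →ₗ[k] T)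
  one_smul φ := LinearMap.ext fun t => congrArg φ.toFun (one_smul B t)
  mul_smul b c φ := LinearMap.ext fun t => congrArg φ.toFun (mul_smul c.unop b.unop t)
  smul_zero _ := rfl
  smul_add _ _ _ := rfl
  add_smul b c φ := LinearMap.ext fun t =>
    (congrArg φ.toFun (add_smul b.unop c.unop t)).trans (LinearMap.map_add (R := k) φ _ _)
  zero_smul φ := LinearMap.ext fun t =>
    (congrArg φ.toFun (zero_smul B t)).trans (LinearMap.map_zero (R := k) φ)

variable (k : Type u) {B : Type u} [Field k] [Ring B] [Algebra k B]

/-- The transpose `Hom_B(d, B) : Hom_B(Q, B) → Hom_B(P, B)`, `φ ↦ φ ∘ d`, of a homomorphism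
`d : P → Q` of right `B`-modules, as a homomorphism of left `B`-modules. -/
def transposeHom {P Q : Type u} [AddCommGroup P] [Module Bᵐᵒᵖ P] [AddCommGroup Q]
    [Module Bᵐᵒᵖ Q] (d : P →ₗ[Bᵐᵒᵖ] Q) : (Q →ₗ[Bᵐᵒᵖ] B) →ₗ[B] (P →ₗ[Bᵐᵒᵖ] B) where
  toFun φ := φ ∘ₗ d
  map_add' _ _ := rfl
  map_smul' _ _ := rfl

/-- The transpose `Tr M = Coker (Hom_B(P₀, B) → Hom_B(P₁, B))`, a left `B`-module, computed from a
minimal projective presentation `P₁ → P₀ → M → 0` of the right `B`-module `M`. -/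
abbrev MinProjPres.Tr {M : ModuleCat.{u} Bᵐᵒᵖ} (p : MinProjPres M) : Type u :=
  (p.P₁ →ₗ[Bᵐᵒᵖ] B) ⧸ LinearMap.range (transposeHom p.d₁)

/-- `D Tr M`, computed from a minimal projective presentation of `M`. -/
def MinProjPres.dTr {M : ModuleCat.{u} Bᵐᵒᵖ} (p : MinProjPres M) : ModuleCat.{u} Bᵐᵒᵖ :=
  ModuleCat.of Bᵐᵒᵖ (DualModule k p.Tr)

/-- The opposite of a finite dimensional algebra is artinian. -/
theorem isArtinianRing_op (k B : Type u) [Field k] [Ring B] [Algebra k B] [Module.Finite k B] :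
    IsArtinianRing Bᵐᵒᵖ :=
  have : Module.Finite k Bᵐᵒᵖ := Module.Finite.equiv (MulOpposite.opLinearEquiv k)
  IsArtinianRing.of_finite k Bᵐᵒᵖ

/-- The Auslander–Reiten translate `τ_B M = D Tr M` of a finitely generated right module `M` over a
finite dimensional `k`-algebra `B`. It is computed from a chosen minimal projective presentation;
up to isomorphism it does not depend on the choice. -/
def tau [Module.Finite k B] (M : ModuleCat.{u} Bᵐᵒᵖ) [Module.Finite Bᵐᵒᵖ M] :
    ModuleCat.{u} Bᵐᵒᵖ :=
  have := isArtinianRing_op k B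
  (Classical.choice (nonempty_minProjPres M)).dTr k

/-- `Hom_B(X, Y) = 0`. -/
def HomVanishes {R : Type u} [Ring R] (X Y : ModuleCat.{u} R) : Prop := ∀ f : X ⟶ Y, f = 0

/-- `M` is `τ_B`-rigid: `Hom_B(M, τ_B M) = 0`. -/
def IsTauRigid [Module.Finite k B] (M : ModuleCat.{u} Bᵐᵒᵖ) [Module.Finite Bᵐᵒᵖ M] : Prop :=
  HomVanishes M (tau k M)

end Translate

section Perp

variable {R : Type u} [Ring R]

/-- The full subcategory `⊥Y` of the finitely generated modules `X` with `Hom(X, Y) = 0`. -/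
def leftPerp (Y : ModuleCat.{u} R) : ObjectProperty (ModuleCat.{u} R) :=
  fun X => Module.Finite R X ∧ HomVanishes X Y

/-- `X` is Ext-projective in `T`: `X` lies in `T` and `Ext¹(X, Y) = 0` for all `Y` in `T`. -/
def IsExtProjective (T : ObjectProperty (ModuleCat.{u} R)) (X : ModuleCat.{u} R) : Prop :=
  T X ∧ ∀ Y : ModuleCat.{u} R, T Y → Subsingleton (Abelian.Ext X Y 1)

end Perp

section Split

/-- `B` is a split extension of `C` by a nilpotent bimodule `E`: algebra homomorphisms
`π : B → C` and `σ : C → B` with `π ∘ σ = 1`, such that `E = ker π` is nilpotent. -/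
structure SplitExtension (k C B : Type u) [Field k] [Ring C] [Algebra k C] [Ring B]
    [Algebra k B] where
  π : B →ₐ[k] C
  σ : C →ₐ[k] B
  π_comp_σ : π.comp σ = AlgHom.id k C
  nilpotent : IsNilpotent (RingHom.ker π)

variable {k C B : Type u} [Field k] [Ring C] [Algebra k C] [Ring B] [Algebra k B]

/-- The relations `m c ⊗ b = m ⊗ σ(c) b` that define `M ⊗_C B` as a quotient of the tensor product
over `ℤ`. The tensor `m ⊗ b` is written `b ⊗ₜ m`, so that Mathlib's action on the first factor is
the right `B`-action `(m ⊗ b) b' = m ⊗ b b'`; the relations are stable under this action. -/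
def inducedRelations (S : SplitExtension k C B) (M : ModuleCat.{u} Cᵐᵒᵖ) :
    Submodule Bᵐᵒᵖ (B ⊗[ℤ] M) :=
  Submodule.span Bᵐᵒᵖ {x | ∃ (m : M) (c : C) (b : B),
    x = b ⊗ₜ[ℤ] (MulOpposite.op c • m) - (S.σ c * b) ⊗ₜ[ℤ] m}

/-- The induced right `B`-module `M ⊗_C B` of a right `C`-module `M`. -/
def SplitExtension.induced (S : SplitExtension k C B) (M : ModuleCat.{u} Cᵐᵒᵖ) :
    ModuleCat.{u} Bᵐᵒᵖ :=
  ModuleCat.of Bᵐᵒᵖ ((B ⊗[ℤ] M) ⧸ inducedRelations S M)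

/-- A right `C`-module `M` as a right `B`-module, through `π : B → C`. -/
def SplitExtension.inflate (S : SplitExtension k C B) (M : ModuleCat.{u} Cᵐᵒᵖ) :
    ModuleCat.{u} Bᵐᵒᵖ :=
  (ModuleCat.restrictScalars (S.π : B →+* C).op).obj M

/-- The right `C`-module `X_C` underlying a right `B`-module `X`, through `σ : C → B`. -/
def SplitExtension.restrict (S : SplitExtension k C B) (X : ModuleCat.{u} Bᵐᵒᵖ) :
    ModuleCat.{u} Cᵐᵒᵖ :=
  (ModuleCat.restrictScalars (S.σ : C →+* B).op).obj X

theorem SplitExtension.π_σ (S : SplitExtension k C B) (c : C) : S.π (S.σ c) = c :=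
  DFunLike.congr_fun S.π_comp_σ c

instance SplitExtension.finite_inflate (S : SplitExtension k C B) (M : ModuleCat.{u} Cᵐᵒᵖ)
    [h : Module.Finite Cᵐᵒᵖ M] : Module.Finite Bᵐᵒᵖ (S.inflate M) := by
  obtain ⟨s, hs⟩ := h.fg_top
  let t : Finset (S.inflate M) := s
  let L : Submodule Bᵐᵒᵖ (S.inflate M) := Submodule.span Bᵐᵒᵖ (t : Set (S.inflate M))
  refine ⟨⟨t, ?_⟩⟩
  rw [eq_top_iff]
  rintro x -
  have key : ∀ y : M, y ∈ Submodule.span Cᵐᵒᵖ (s : Set M) → @id (S.inflate M) y ∈ L := by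
    intro y hy
    induction hy using Submodule.span_induction with
    | mem y hy => exact Submodule.subset_span hy
    | zero => exact L.zero_mem
    | add y z _ _ hy hz => exact L.add_mem hy hz
    | smul c y _ hy =>
      have h1 := L.smul_mem (MulOpposite.op (S.σ c.unop)) hy
      have h2 : (MulOpposite.op (S.π (S.σ c.unop)) : Cᵐᵒᵖ) • y = c • y := by
        rw [S.π_σ]; rfl
      rw [← h2]
      exact h1
  exact key x (hs ▸ Submodule.mem_top)

end Split

end

end TauRigid

/-! Induction is left adjoint to restriction along `σ`, so `Hom_B(M ⊗ B, τ_B M) = 0` and `Hom_C(M,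
(τ_B M)_C) = 0` are the same condition (`homVanishes_induced_iff`). It remains to see that `Ext¹_B(M
⊗ B, Y) = 0` whenever `Hom_B(Y, τ_B M) = 0`. Take minimal presentations `P₁ → P₀ → M` over `C` and
`Q₁ → Q₀ → M` over `B`. By duality, the condition on `Y` says that every map `Q₁ → Y` factors
through `Q₀` (`MinProjPres.exists_factor`). Since `E` is nilpotent, tensoring a projective cover
over `C` with `B` gives a projective cover over `B` of the same module. Hence `P₀ ⊗ B ≅ Q₀`, and `P₁
⊗ B` is a direct summand of `Q₁`, compatibly with the differentials (`exists_comparison`). So every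
map `P₁ ⊗ B → Y` factors through `P₀ ⊗ B`; as `P₁ ⊗ B → P₀ ⊗ B → M ⊗ B → 0` is exact, the `Ext`
group vanishes. -/

namespace TauRigid

noncomputable section

/-! ### Projective covers and a criterion for `Ext¹ = 0` -/

section ProjectiveCover

variable {R : Type u} [Ring R]

/-- A homomorphism between projective covers of the same module is an isomorphism. -/
theorem IsProjectiveCover.bijective_of_comp_eq {P P' M : Type u} [AddCommGroup P] [Module R P]
    [AddCommGroup P'] [Module R P'] [AddCommGroup M] [Module R M] {f : P →ₗ[R] M}
    {f' : P' →ₗ[R] M} (hf : IsProjectiveCover f) (hf' : IsProjectiveCover f') {e : P →ₗ[R] P'}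
    (he : f' ∘ₗ e = f) : Function.Bijective e := by
  have key : ∀ {Q Q' : Type u} [AddCommGroup Q] [Module R Q] [AddCommGroup Q'] [Module R Q']
      {g : Q →ₗ[R] M} {g' : Q' →ₗ[R] M} (_ : IsProjectiveCover g) (_ : IsProjectiveCover g')
      {a : Q →ₗ[R] Q'}, g' ∘ₗ a = g → Function.Surjective a := by
    intro Q Q' _ _ _ _ g g' hg hg' a ha
    rw [← LinearMap.range_eq_top]
    -- The range of `a` together with `ker g'` fills `Q'`: correct `x` by `a y`, where `y` has the
    -- same image in `M`.
    refine hg'.superfluous _ (eq_top_iff.2 fun x _ => ?_)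
    obtain ⟨y, hy⟩ := hg.surjective (g' x)
    refine Submodule.mem_sup.2 ⟨a y, ⟨y, rfl⟩, x - a y, ?_, add_sub_cancel _ _⟩
    rw [LinearMap.mem_ker, map_sub, ← hy, ← ha, LinearMap.comp_apply, sub_self]
  have := hf'.projective
  have hes := key hf hf' he
  obtain ⟨s, hs⟩ := Module.projective_lifting_property e LinearMap.id hes
  have hfs : f ∘ₗ s = f' := by rw [← he, LinearMap.comp_assoc, hs, LinearMap.comp_id]
  -- The section `s` is itself a map of covers, hence surjective, and this makes its left inverse
  -- `e` injective.
  have hss := key hf' hf hfs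
  refine ⟨fun x y hxy => ?_, hes⟩
  obtain ⟨x, rfl⟩ := hss x
  obtain ⟨y, rfl⟩ := hss y
  have h1 := LinearMap.congr_fun hs x
  have h2 := LinearMap.congr_fun hs y
  simp only [LinearMap.comp_apply, LinearMap.id_apply] at h1 h2
  rw [← h1, ← h2, hxy]

/-- If `P` is projective, `g : P → X` is surjective and every homomorphism `ker g → Y` extends to
`P`, then `Ext¹(X, Y) = 0`. -/
theorem subsingleton_ext_one_of_extends {P : Type u} [AddCommGroup P] [Module R P]
    [Module.Projective R P] {X : ModuleCat.{u} R} (g : P →ₗ[R] X) (hg : Function.Surjective g)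
    (Y : ModuleCat.{u} R)
    (h : ∀ u : LinearMap.ker g →ₗ[R] Y, ∃ w : P →ₗ[R] Y, w ∘ₗ (LinearMap.ker g).subtype = u) :
    Subsingleton (Abelian.Ext X Y 1) := by
  have hS := LinearMap.shortExact_shortComplexKer hg
  have : Projective (ModuleCat.of R P) := inferInstance
  refine subsingleton_of_forall_eq 0 fun x => ?_
  -- As `Ext¹(P, Y) = 0`, every class comes from some `ker g → Y` by the connecting map, which kills
  -- maps that extend to `P`.
  obtain ⟨x₁, rfl⟩ := Abelian.Ext.contravariant_sequence_exact₃ hS Y x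
    (@Subsingleton.elim _
      (Abelian.Ext.subsingleton_of_projective (ModuleCat.of R P) Y 0) _ _) (add_zero 1)
  obtain ⟨f, rfl⟩ := Abelian.Ext.homEquiv₀.symm.surjective x₁
  obtain ⟨w, hw⟩ := h f.hom
  have hf : f = ModuleCat.ofHom (LinearMap.ker g).subtype ≫ ModuleCat.ofHom w :=
    ModuleCat.hom_ext hw.symm
  change hS.extClass.comp (Abelian.Ext.mk₀ f) _ = 0
  rw [hf, ← Abelian.Ext.mk₀_comp_mk₀]
  exact hS.extClass_comp_assoc _

end ProjectiveCover

/-! ### Maps into `D Tr M` and factorization through `P₁ → P₀` -/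

section Translate

variable {k B : Type u} [Field k] [Ring B] [Algebra k B]

/-- The homomorphism of right modules `B → Y`, `b ↦ y b`. -/
def orbitHom {Y : Type u} [AddCommGroup Y] [Module Bᵐᵒᵖ Y] (y : Y) : B →ₗ[Bᵐᵒᵖ] Y where
  toFun b := MulOpposite.op b • y
  map_add' b c := by rw [MulOpposite.op_add, add_smul]
  map_smul' b c := by
    rw [RingHom.id_apply, MulOpposite.smul_eq_mul_unop, MulOpposite.op_mul, mul_smul,
      MulOpposite.op_unop]

@[simp]
theorem orbitHom_apply {Y : Type u} [AddCommGroup Y] [Module Bᵐᵒᵖ Y] (y : Y) (b : B) :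
    orbitHom y b = MulOpposite.op b • y := rfl

/-- Every homomorphism from a finitely generated projective right module `P` to `Y` is a sum of
homomorphisms `x ↦ y φ(x)` with `y ∈ Y` and `φ : P → B`. -/
theorem exists_eq_sum_orbitHom_comp {P Y : Type u} [AddCommGroup P] [Module Bᵐᵒᵖ P]
    [Module.Finite Bᵐᵒᵖ P] [Module.Projective Bᵐᵒᵖ P] [AddCommGroup Y] [Module Bᵐᵒᵖ Y]
    (u : P →ₗ[Bᵐᵒᵖ] Y) :
    ∃ (n : ℕ) (y : Fin n → Y) (φ : Fin n → P →ₗ[Bᵐᵒᵖ] B),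
      u = ∑ i, orbitHom (y i) ∘ₗ φ i := by
  obtain ⟨n, f, g, -, -, hfg⟩ := Module.Finite.exists_comp_eq_id_of_projective Bᵐᵒᵖ P
  let unop : Bᵐᵒᵖ →ₗ[Bᵐᵒᵖ] B :=
    { toFun := MulOpposite.unop
      map_add' := fun _ _ => rfl
      map_smul' := fun _ _ => rfl }
  -- A dual basis of `P`, read off from its splitting `f ∘ g = id` through a free module.
  refine ⟨n, fun i => u (f (Pi.single i 1)), fun i => unop ∘ₗ LinearMap.proj i ∘ₗ g, ?_⟩
  ext x
  have hx : f (g x) = x := LinearMap.congr_fun hfg x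
  rw [LinearMap.sum_apply]
  conv_lhs => rw [← hx, pi_eq_sum_univ' (g x)]
  rw [map_sum, map_sum]
  refine Finset.sum_congr rfl fun i _ => ?_
  rw [map_smul, map_smul]
  rfl

variable (k) in
/-- The homomorphism `Y → D Tr M` given by a linear form `ξ` on `Hom(P₁, Y)` that vanishes on the
image of `Hom(P₀, Y)`. It sends `y` to the functional induced by `φ ↦ ξ(x ↦ y φ(x))`. -/
def MinProjPres.homOfForm {M : ModuleCat.{u} Bᵐᵒᵖ} (p : MinProjPres M) {Y : Type u}
    [AddCommGroup Y] [Module Bᵐᵒᵖ Y] [Module k Y] [IsScalarTower k Bᵐᵒᵖ Y]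
    [SMulCommClass Bᵐᵒᵖ k Y] (ξ : (p.P₁ →ₗ[Bᵐᵒᵖ] Y) →ₗ[k] k)
    (hξ : ∀ w : p.P₀ →ₗ[Bᵐᵒᵖ] Y, ξ (w ∘ₗ p.d₁) = 0) : Y →ₗ[Bᵐᵒᵖ] DualModule k p.Tr where
  toFun y := (((LinearMap.range (transposeHom p.d₁)).restrictScalars k).liftQ
    (ξ ∘ₗ
      ({ toFun := fun φ => orbitHom y ∘ₗ φ
         map_add' := fun φ ψ => LinearMap.comp_add _ _ _
         map_smul' := fun c φ => by
          ext x
          simp } :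
        (p.P₁ →ₗ[Bᵐᵒᵖ] B) →ₗ[k] (p.P₁ →ₗ[Bᵐᵒᵖ] Y)))
    (by
      rintro _ ⟨ψ, rfl⟩
      exact hξ (orbitHom y ∘ₗ ψ))) ∘ₗ
    (Submodule.Quotient.restrictScalarsEquiv k (LinearMap.range (transposeHom p.d₁))).symm.toLinearMap
  map_add' y z := by
    refine LinearMap.ext fun t => ?_
    obtain ⟨φ, rfl⟩ := Submodule.Quotient.mk_surjective _ t
    change ξ (orbitHom (y + z) ∘ₗ φ) = ξ (orbitHom y ∘ₗ φ) + ξ (orbitHom z ∘ₗ φ)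
    rw [← map_add]
    congr 1
    ext x
    simp
  map_smul' b y := by
    refine LinearMap.ext fun t => ?_
    obtain ⟨φ, rfl⟩ := Submodule.Quotient.mk_surjective _ t
    change ξ (orbitHom (b • y) ∘ₗ φ) = ξ (orbitHom y ∘ₗ (b.unop • φ))
    congr 1
    ext x
    simp [mul_smul]

/-- If `Hom(Y, D Tr M) = 0` then every homomorphism `P₁ → Y` factors through `P₁ → P₀`. -/
theorem MinProjPres.exists_factor {M : ModuleCat.{u} Bᵐᵒᵖ} (p : MinProjPres M)
    {Y : ModuleCat.{u} Bᵐᵒᵖ} (hY : HomVanishes Y (p.dTr k)) (v : p.P₁ →ₗ[Bᵐᵒᵖ] Y) :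
    ∃ w : p.P₀ →ₗ[Bᵐᵒᵖ] Y, w ∘ₗ p.d₁ = v := by
  let : Module k Y := Module.compHom Y (algebraMap k Bᵐᵒᵖ)
  have : IsScalarTower k Bᵐᵒᵖ Y := IsScalarTower.of_algebraMap_smul fun _ _ => rfl
  have : SMulCommClass Bᵐᵒᵖ k Y := IsScalarTower.to_smulCommClass'
  have := p.finite₁
  have := p.cover₁.projective
  let res : (p.P₀ →ₗ[Bᵐᵒᵖ] Y) →ₗ[k] (p.P₁ →ₗ[Bᵐᵒᵖ] Y) :=
    { toFun := fun w => w ∘ₗ p.d₁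
      map_add' := fun _ _ => rfl
      map_smul' := fun _ _ => rfl }
  -- A linear form `ξ` separates `v` from the image of `Hom(P₀, Y)`. The map `Y → D Tr M` it defines
  -- is zero, so `ξ` kills all `x ↦ y φ(x)`, hence also their sum `v`.
  by_contra hv
  obtain ⟨ξ, hξv, hξ⟩ := Submodule.exists_le_ker_of_notMem (p := LinearMap.range res) hv
  have hξ' : ∀ w : p.P₀ →ₗ[Bᵐᵒᵖ] Y, ξ (w ∘ₗ p.d₁) = 0 := fun w => hξ ⟨w, rfl⟩
  have h0 : p.homOfForm k ξ hξ' = 0 :=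
    congrArg ModuleCat.Hom.hom (hY (ModuleCat.ofHom (p.homOfForm k ξ hξ')))
  refine hξv ?_
  obtain ⟨n, y, φ, rfl⟩ := exists_eq_sum_orbitHom_comp v
  rw [map_sum]
  refine Finset.sum_eq_zero fun i _ => ?_
  exact LinearMap.congr_fun (LinearMap.congr_fun h0 (y i) : (_ : p.Tr →ₗ[k] k) = 0)
    (Submodule.Quotient.mk (φ i))

end Translate

/-! ### Induction along `σ`: adjunction, projectives, right exactness -/

namespace SplitExtension

variable {k C B : Type u} [Field k] [Ring C] [Algebra k C] [Ring B] [Algebra k B]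
  (S : SplitExtension k C B)

/-- The homomorphism `N → N ⊗_C B`, `n ↦ n ⊗ 1`, of abelian groups. -/
def incl (N : ModuleCat.{u} Cᵐᵒᵖ) : N →+ S.induced N :=
  AddMonoidHom.mk' (fun n => (inducedRelations S N).mkQ ((1 : B) ⊗ₜ[ℤ] n)) fun m n => by
    rw [TensorProduct.tmul_add, map_add]
    rfl

theorem incl_smul {N : ModuleCat.{u} Cᵐᵒᵖ} (c : Cᵐᵒᵖ) (n : N) :
    S.incl N (c • n) = MulOpposite.op (S.σ c.unop) • S.incl N n := by
  change (inducedRelations S N).mkQ _ =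
    MulOpposite.op (S.σ c.unop) • (inducedRelations S N).mkQ ((1 : B) ⊗ₜ[ℤ] n)
  rw [← map_smul, ← sub_eq_zero, ← map_sub, ← LinearMap.mem_ker, Submodule.ker_mkQ]
  refine Submodule.subset_span ⟨n, c.unop, 1, ?_⟩
  rw [TensorProduct.smul_tmul', op_smul_eq_mul, one_mul, mul_one, MulOpposite.op_unop]

/-- The unit `N → (N ⊗_C B)_C`, `n ↦ n ⊗ 1`. -/
def unit (N : ModuleCat.{u} Cᵐᵒᵖ) : N →ₗ[Cᵐᵒᵖ] S.restrict (S.induced N) where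
  toFun := S.incl N
  map_add' := (S.incl N).map_add
  map_smul' := S.incl_smul

/-- A submodule of `N ⊗_C B` that contains all `n ⊗ 1` is everything. -/
theorem eq_top_of_incl_mem {N : ModuleCat.{u} Cᵐᵒᵖ} {L : Submodule Bᵐᵒᵖ (S.induced N)}
    (h : ∀ n : N, S.incl N n ∈ L) : L = ⊤ := by
  rw [eq_top_iff]
  rintro x -
  obtain ⟨t, rfl⟩ := Submodule.mkQ_surjective (inducedRelations S N) x
  induction t using TensorProduct.induction_on with
  | zero => rw [map_zero]; exact L.zero_mem
  | add s t hs ht => rw [map_add]; exact L.add_mem hs ht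
  | tmul b n =>
    have := L.smul_mem (MulOpposite.op b) (h n)
    change MulOpposite.op b • (inducedRelations S N).mkQ ((1 : B) ⊗ₜ[ℤ] n) ∈ L at this
    rwa [← map_smul, TensorProduct.smul_tmul', op_smul_eq_mul, one_mul] at this

theorem induced_hom_ext {N : ModuleCat.{u} Cᵐᵒᵖ} {Y : Type u} [AddCommGroup Y] [Module Bᵐᵒᵖ Y]
    {f g : S.induced N →ₗ[Bᵐᵒᵖ] Y} (h : ∀ n : N, f (S.incl N n) = g (S.incl N n)) : f = g :=
  LinearMap.eqLocus_eq_top.1 (S.eq_top_of_incl_mem h)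

instance finite_induced (N : ModuleCat.{u} Cᵐᵒᵖ) [hN : Module.Finite Cᵐᵒᵖ N] :
    Module.Finite Bᵐᵒᵖ (S.induced N) := by
  obtain ⟨s, hs⟩ := hN.fg_top
  let L : Submodule Bᵐᵒᵖ (S.induced N) := Submodule.span Bᵐᵒᵖ (S.incl N '' (s : Set N))
  refine ⟨Submodule.fg_def.2 ⟨_, s.finite_toSet.image (S.incl N), S.eq_top_of_incl_mem ?_⟩⟩
  intro n
  change S.incl N n ∈ L
  have hn : n ∈ Submodule.span Cᵐᵒᵖ (s : Set N) := hs ▸ Submodule.mem_top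
  induction hn using Submodule.span_induction with
  | mem y hy => exact Submodule.subset_span ⟨y, hy, rfl⟩
  | zero => rw [map_zero]; exact L.zero_mem
  | add y z _ _ hy hz => rw [map_add]; exact L.add_mem hy hz
  | smul c y _ hy => rw [incl_smul]; exact L.smul_mem (MulOpposite.op (S.σ c.unop)) hy

/-- The homomorphism `N ⊗_C B → Y`, `n ⊗ b ↦ f(n) b`, that corresponds to `f : N → Y_C`. -/
def lift {N : ModuleCat.{u} Cᵐᵒᵖ} {Y : ModuleCat.{u} Bᵐᵒᵖ} (f : N →ₗ[Cᵐᵒᵖ] S.restrict Y) :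
    S.induced N →ₗ[Bᵐᵒᵖ] Y :=
  let F : N → Y := f
  have hadd : ∀ m n, F (m + n) = F m + F n := f.map_add
  (inducedRelations S N).liftQ
    (TensorProduct.AlgebraTensorModule.lift
      { toFun := fun b =>
          (AddMonoidHom.mk' (fun n => MulOpposite.op b • F n) fun m n => by
            rw [hadd, smul_add]).toIntLinearMap
        map_add' := fun b c => LinearMap.ext fun n => add_smul _ _ _
        map_smul' := fun b c => LinearMap.ext fun n => mul_smul _ _ _ })
    (by
      rw [inducedRelations, Submodule.span_le]
      rintro _ ⟨m, c, b, rfl⟩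
      have hc : F (MulOpposite.op c • m) = MulOpposite.op (S.σ c) • F m := f.map_smul _ _
      change _ = _
      rw [map_sub, TensorProduct.AlgebraTensorModule.lift_tmul,
        TensorProduct.AlgebraTensorModule.lift_tmul, sub_eq_zero]
      change MulOpposite.op b • F _ = MulOpposite.op (S.σ c * b) • F m
      rw [hc, MulOpposite.op_mul, mul_smul])

theorem lift_incl {N : ModuleCat.{u} Cᵐᵒᵖ} {Y : ModuleCat.{u} Bᵐᵒᵖ}
    (f : N →ₗ[Cᵐᵒᵖ] S.restrict Y) (n : N) : S.lift f (S.incl N n) = f n :=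
  one_smul Bᵐᵒᵖ (show Y from f n)

/-- A homomorphism of right `B`-modules, as a homomorphism of right `C`-modules. -/
def restrictHom {X Y : ModuleCat.{u} Bᵐᵒᵖ} (f : X →ₗ[Bᵐᵒᵖ] Y) :
    S.restrict X →ₗ[Cᵐᵒᵖ] S.restrict Y where
  toFun := f
  map_add' := f.map_add
  map_smul' c := f.map_smul (MulOpposite.op (S.σ c.unop))

/-- A homomorphism of right `C`-modules, as a homomorphism of right `B`-modules. -/
def inflateHom {M N : ModuleCat.{u} Cᵐᵒᵖ} (f : M →ₗ[Cᵐᵒᵖ] N) :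
    S.inflate M →ₗ[Bᵐᵒᵖ] S.inflate N where
  toFun := f
  map_add' := f.map_add
  map_smul' b := f.map_smul (MulOpposite.op (S.π b.unop))

/-- The adjunction between induction and restriction, in the only form needed for the final
equivalence. -/
theorem homVanishes_induced_iff (N : ModuleCat.{u} Cᵐᵒᵖ) (Y : ModuleCat.{u} Bᵐᵒᵖ) :
    HomVanishes (S.induced N) Y ↔ HomVanishes N (S.restrict Y) := by
  constructor
  · intro h f
    let F : N →ₗ[Cᵐᵒᵖ] S.restrict Y := f.hom
    have h0 : S.lift F = 0 := congrArg ModuleCat.Hom.hom (h (ModuleCat.ofHom (S.lift F)))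
    refine ModuleCat.hom_ext (LinearMap.ext fun n => ?_)
    exact (S.lift_incl F n).symm.trans (LinearMap.congr_fun h0 _)
  · intro h f
    have h0 : S.restrictHom f.hom ∘ₗ S.unit N = 0 :=
      congrArg ModuleCat.Hom.hom
        (h (ModuleCat.ofHom (X := N) (Y := S.restrict Y) (S.restrictHom f.hom ∘ₗ S.unit N)))
    exact ModuleCat.hom_ext (S.induced_hom_ext fun n => LinearMap.congr_fun h0 n)

/-- Restriction preserves surjections, so its left adjoint preserves projectives: lift the unit over
`C`, then pass to the adjoint map. -/
theorem projective_induced (P : ModuleCat.{u} Cᵐᵒᵖ) [Module.Projective Cᵐᵒᵖ P] :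
    Module.Projective Bᵐᵒᵖ (S.induced P) := by
  refine Module.Projective.of_lifting_property'' fun f hf => ?_
  let F := ModuleCat.of Bᵐᵒᵖ (S.induced P →₀ Bᵐᵒᵖ)
  let g : F →ₗ[Bᵐᵒᵖ] S.induced P := f
  obtain ⟨h, hh⟩ := Module.projective_lifting_property (S.restrictHom g) (S.unit P) hf
  refine ⟨S.lift (Y := F) h, S.induced_hom_ext fun n => ?_⟩
  rw [LinearMap.comp_apply, lift_incl]
  exact LinearMap.congr_fun hh n

/-- The homomorphism `M ⊗_C B → N ⊗_C B` induced by `f : M → N`. -/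
def inducedHom {M N : ModuleCat.{u} Cᵐᵒᵖ} (f : M →ₗ[Cᵐᵒᵖ] N) :
    S.induced M →ₗ[Bᵐᵒᵖ] S.induced N :=
  S.lift (S.unit N ∘ₗ f)

theorem inducedHom_incl {M N : ModuleCat.{u} Cᵐᵒᵖ} (f : M →ₗ[Cᵐᵒᵖ] N) (m : M) :
    S.inducedHom f (S.incl M m) = S.incl N (f m) :=
  S.lift_incl _ _

theorem inducedHom_surjective {M N : ModuleCat.{u} Cᵐᵒᵖ} {f : M →ₗ[Cᵐᵒᵖ] N}
    (hf : Function.Surjective f) : Function.Surjective (S.inducedHom f) := by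
  rw [← LinearMap.range_eq_top]
  refine S.eq_top_of_incl_mem fun n => ?_
  obtain ⟨m, rfl⟩ := hf n
  exact ⟨S.incl M m, S.inducedHom_incl f m⟩

/-- The induction functor is right exact. -/
theorem ker_inducedHom_le {L M N : ModuleCat.{u} Cᵐᵒᵖ} {f : L →ₗ[Cᵐᵒᵖ] M} {g : M →ₗ[Cᵐᵒᵖ] N}
    (hfg : LinearMap.ker g ≤ LinearMap.range f) (hg : Function.Surjective g) :
    LinearMap.ker (S.inducedHom g) ≤ LinearMap.range (S.inducedHom f) := by
  -- Let `Q` be the cokernel of `f ⊗ B`. The map `M → Q` kills `ker g`, so it descends to `N`; by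
  -- adjunction the quotient map factors through `g ⊗ B`, whose kernel therefore lies in `I`.
  let I := LinearMap.range (S.inducedHom f)
  let Q := ModuleCat.of Bᵐᵒᵖ (S.induced M ⧸ I)
  let q : S.induced M →ₗ[Bᵐᵒᵖ] Q := I.mkQ
  let a : M →ₗ[Cᵐᵒᵖ] S.restrict Q := S.restrictHom q ∘ₗ S.unit M
  have ha : LinearMap.ker g ≤ LinearMap.ker a := by
    intro m hm
    obtain ⟨l, rfl⟩ := hfg hm
    exact (Submodule.Quotient.mk_eq_zero I).2 ⟨S.incl L l, S.inducedHom_incl f l⟩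
  let b : N →ₗ[Cᵐᵒᵖ] S.restrict Q :=
    (LinearMap.ker g).liftQ a ha ∘ₗ (g.quotKerEquivOfSurjective hg).symm.toLinearMap
  have hb : ∀ m, b (g m) = a m := by
    intro m
    have : (g.quotKerEquivOfSurjective hg).symm (g m) = Submodule.Quotient.mk m := by
      rw [LinearEquiv.symm_apply_eq]; rfl
    change (LinearMap.ker g).liftQ a ha ((g.quotKerEquivOfSurjective hg).symm (g m)) = a m
    rw [this]; rfl
  have hq : S.lift b ∘ₗ S.inducedHom g = q := by
    refine S.induced_hom_ext fun m => ?_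
    rw [LinearMap.comp_apply, inducedHom_incl, lift_incl, hb]
    rfl
  intro x hx
  have : q x = 0 := by rw [← hq, LinearMap.comp_apply, LinearMap.mem_ker.1 hx, map_zero]
  exact (Submodule.Quotient.mk_eq_zero I).1 this

/-! ### Nilpotence of `E` and induced projective covers -/

/-- A homomorphism `f : P → N` of right `C`-modules gives `P ⊗_C B → N`, `p ⊗ b ↦ f(p) π(b)`. -/
def coverHom {P N : ModuleCat.{u} Cᵐᵒᵖ} (f : P →ₗ[Cᵐᵒᵖ] N) :
    S.induced P →ₗ[Bᵐᵒᵖ] S.inflate N :=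
  S.lift
    { toFun := f
      map_add' := f.map_add
      map_smul' := fun c p => by
        change f (c • p) = (MulOpposite.op (S.π (S.σ c.unop)) : Cᵐᵒᵖ) • f p
        rw [S.π_σ, map_smul]
        rfl }

theorem coverHom_incl {P N : ModuleCat.{u} Cᵐᵒᵖ} (f : P →ₗ[Cᵐᵒᵖ] N) (p : P) :
    S.coverHom f (S.incl P p) = f p :=
  S.lift_incl _ _

theorem inflateHom_comp_coverHom {P N L : ModuleCat.{u} Cᵐᵒᵖ} (f : P →ₗ[Cᵐᵒᵖ] N)
    (g : N →ₗ[Cᵐᵒᵖ] L) : S.inflateHom g ∘ₗ S.coverHom f = S.coverHom (g ∘ₗ f) := by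
  refine S.induced_hom_ext fun p => ?_
  rw [LinearMap.comp_apply, coverHom_incl, coverHom_incl]
  rfl

theorem coverHom_comp_inducedHom {P N L : ModuleCat.{u} Cᵐᵒᵖ} (f : P →ₗ[Cᵐᵒᵖ] N)
    (g : N →ₗ[Cᵐᵒᵖ] L) : S.coverHom g ∘ₗ S.inducedHom f = S.coverHom (g ∘ₗ f) := by
  refine S.induced_hom_ext fun p => ?_
  rw [LinearMap.comp_apply, inducedHom_incl, coverHom_incl, coverHom_incl]
  rfl

/-- The homomorphism `P ⊗_C B → P`, `p ⊗ b ↦ p π(b)`, of abelian groups. -/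
def proj (P : ModuleCat.{u} Cᵐᵒᵖ) : S.induced P →+ P :=
  AddMonoidHom.mk' (fun x => S.coverHom (LinearMap.id : P →ₗ[Cᵐᵒᵖ] P) x) fun x y =>
    (S.coverHom (LinearMap.id : P →ₗ[Cᵐᵒᵖ] P)).map_add x y

theorem proj_incl {P : ModuleCat.{u} Cᵐᵒᵖ} (p : P) : S.proj P (S.incl P p) = p :=
  S.coverHom_incl LinearMap.id p

theorem proj_smul {P : ModuleCat.{u} Cᵐᵒᵖ} (b : Bᵐᵒᵖ) (x : S.induced P) :
    S.proj P (b • x) = MulOpposite.op (S.π b.unop) • S.proj P x :=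
  (S.coverHom (LinearMap.id : P →ₗ[Cᵐᵒᵖ] P)).map_smul b x

theorem coverHom_apply {P N : ModuleCat.{u} Cᵐᵒᵖ} (f : P →ₗ[Cᵐᵒᵖ] N) (x : S.induced P) :
    S.coverHom f x = f (S.proj P x) :=
  (LinearMap.congr_fun (S.inflateHom_comp_coverHom LinearMap.id f) x).symm

/-- Nakayama's lemma for the nilpotent ideal `E = ker π`: if `X = L + X E` then `L = X`. -/
theorem eq_top_of_sup_smul_ker {X : Type u} [AddCommGroup X] [Module Bᵐᵒᵖ X]
    (L : Submodule Bᵐᵒᵖ X)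
    (h : L ⊔ Submodule.span Bᵐᵒᵖ {x | ∃ e : B, S.π e = 0 ∧ ∃ y : X, x = MulOpposite.op e • y} = ⊤) :
    L = ⊤ := by
  -- Iterating the hypothesis gives `X = L + X Eⁿ` for all `n`.
  have key : ∀ n : ℕ, L ⊔ Submodule.span Bᵐᵒᵖ
      {x | ∃ e ∈ RingHom.ker S.π ^ n, ∃ y : X, x = MulOpposite.op e • y} = ⊤ := by
    intro n
    induction n with
    | zero =>
      refine eq_top_iff.2 (le_trans ?_ le_sup_right)
      intro x _
      refine Submodule.subset_span ⟨1, ?_, x, (one_smul _ _).symm⟩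
      rw [Submodule.pow_zero, Ideal.one_eq_top]
      exact Submodule.mem_top
    | succ n ih =>
      rw [eq_top_iff]
      refine ih.symm.le.trans (sup_le le_sup_left (Submodule.span_le.2 ?_))
      rintro _ ⟨e, he, y, rfl⟩
      have hy : y ∈ L ⊔ _ := h.symm ▸ Submodule.mem_top
      obtain ⟨l, hl, z, hz, rfl⟩ := Submodule.mem_sup.1 hy
      rw [smul_add]
      refine Submodule.add_mem _ (Submodule.mem_sup_left (L.smul_mem _ hl))
        (Submodule.mem_sup_right ?_)
      clear hy
      -- The element `e` must vary: a scalar is absorbed by `(z b) e = z (b e)`, with `b e` again in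
      -- the power of the ideal.
      induction hz using Submodule.span_induction generalizing e with
      | mem z hz =>
        obtain ⟨e', he', z, rfl⟩ := hz
        refine Submodule.subset_span ⟨e' * e, ?_, z, ?_⟩
        · rw [Ideal.IsTwoSided.pow_succ]
          exact Ideal.mul_mem_mul he' he
        · rw [MulOpposite.op_mul, mul_smul]
      | zero => rw [smul_zero]; exact Submodule.zero_mem _
      | add a b _ _ ha hb => rw [smul_add]; exact Submodule.add_mem _ (ha e he) (hb e he)
      | smul b z _ hz =>
        rw [← mul_smul]
        have := hz (b.unop * e) (Ideal.mul_mem_left _ _ he)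
        exact this
  obtain ⟨n, hn⟩ := S.nilpotent
  have := key n
  rw [hn] at this
  rw [← this, eq_comm, sup_eq_left, Submodule.span_le]
  rintro _ ⟨e, he, y, rfl⟩
  rw [show e = 0 from he, MulOpposite.op_zero, zero_smul]
  exact L.zero_mem

/-- In `P ⊗_C B` every element `x` is congruent to `p ⊗ 1` modulo `(P ⊗_C B) E`, where `p ∈ P` is
the image of `x`. -/
theorem sub_incl_proj_mem (P : ModuleCat.{u} Cᵐᵒᵖ) (x : S.induced P) :
    x - S.incl P (S.proj P x) ∈ Submodule.span Bᵐᵒᵖ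
      {x | ∃ e : B, S.π e = 0 ∧ ∃ y : S.induced P, x = MulOpposite.op e • y} := by
  let W := Submodule.span Bᵐᵒᵖ
    {x | ∃ e : B, S.π e = 0 ∧ ∃ y : S.induced P, x = MulOpposite.op e • y}
  -- The elements with the claimed property form a `B`-submodule because `b - σ(π(b))` lies in `E`;
  -- it contains the generators `p ⊗ 1`.
  let V : Submodule Bᵐᵒᵖ (S.induced P) :=
    { carrier := {x | x - S.incl P (S.proj P x) ∈ W}
      add_mem' := by
        intro x y hx hy
        rw [Set.mem_ofPred_eq, map_add, map_add, add_sub_add_comm]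
        exact W.add_mem hx hy
      zero_mem' := by
        rw [Set.mem_ofPred_eq, map_zero, map_zero, sub_zero]
        exact W.zero_mem
      smul_mem' := by
        intro b x hx
        have h : MulOpposite.op (b.unop - S.σ (S.π b.unop)) • S.incl P (S.proj P x) ∈ W :=
          Submodule.subset_span ⟨_, by rw [map_sub, S.π_σ, sub_self], _, rfl⟩
        rw [MulOpposite.op_sub, sub_smul, MulOpposite.op_unop] at h
        have := W.add_mem (W.smul_mem b hx) h
        rw [smul_sub, sub_add_sub_cancel] at this
        rwa [Set.mem_ofPred_eq, proj_smul, incl_smul] }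
  have hV : V = ⊤ := S.eq_top_of_incl_mem fun p => by
    change S.incl P p - S.incl P (S.proj P (S.incl P p)) ∈ W
    rw [proj_incl, sub_self]
    exact W.zero_mem
  exact (hV.symm ▸ Submodule.mem_top : x ∈ V)

/-- If `f : P → N` is a projective cover of right `C`-modules, then `P ⊗_C B → N` is a projective
cover of right `B`-modules. -/
theorem isProjectiveCover_coverHom {P N : ModuleCat.{u} Cᵐᵒᵖ} {f : P →ₗ[Cᵐᵒᵖ] N}
    (hf : IsProjectiveCover f) : IsProjectiveCover (S.coverHom f) := by
  have := hf.projective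
  refine ⟨S.projective_induced P, fun n => ?_, fun L hL => ?_⟩
  · obtain ⟨p, hp⟩ := hf.surjective n
    exact ⟨S.incl P p, (S.coverHom_incl f p).trans hp⟩
  -- The image of `L` in `P` supplements `ker f`, so it is all of `P`. Then `L` fills `P ⊗ B` modulo
  -- `(P ⊗ B) E`, and Nakayama applies.
  · let L' : Submodule Cᵐᵒᵖ P :=
      { carrier := {p | ∃ x ∈ L, S.proj P x = p}
        add_mem' := by
          rintro _ _ ⟨x, hx, rfl⟩ ⟨y, hy, rfl⟩
          exact ⟨x + y, L.add_mem hx hy, map_add _ x y⟩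
        zero_mem' := ⟨0, L.zero_mem, map_zero _⟩
        smul_mem' := by
          rintro c _ ⟨x, hx, rfl⟩
          refine ⟨MulOpposite.op (S.σ c.unop) • x, L.smul_mem _ hx, ?_⟩
          rw [proj_smul, MulOpposite.unop_op, S.π_σ, MulOpposite.op_unop] }
    have hL' : L' = ⊤ := by
      refine hf.superfluous L' (eq_top_iff.2 fun p _ => ?_)
      have hp : S.incl P p ∈ L ⊔ LinearMap.ker (S.coverHom f) := hL ▸ Submodule.mem_top
      obtain ⟨x, hx, y, hy, hxy⟩ := Submodule.mem_sup.1 hp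
      refine Submodule.mem_sup.2 ⟨S.proj P x, ⟨x, hx, rfl⟩, S.proj P y, ?_, ?_⟩
      · exact (S.coverHom_apply f y).symm.trans hy
      · rw [← map_add, hxy, proj_incl]
    refine S.eq_top_of_sup_smul_ker L (eq_top_iff.2 fun x _ => ?_)
    obtain ⟨y, hy, hxy⟩ : S.proj P x ∈ L' := hL' ▸ Submodule.mem_top
    have hmem := S.sub_incl_proj_mem P (x - y)
    rw [map_sub, hxy, sub_self, map_zero, sub_zero] at hmem
    exact Submodule.mem_sup.2 ⟨y, hy, x - y, hmem, add_sub_cancel _ _⟩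

/-! ### Comparison of presentations and vanishing of `Ext¹` -/

/-- Let `P₁ → P₀ → M` and `Q₁ → Q₀ → M` be minimal projective presentations of `M` over `C` and
over `B`. The comparison map from `P₁ ⊗_C B → P₀ ⊗_C B` to `Q₁ → Q₀` is a split monomorphism in
degree one. -/
theorem exists_comparison {M : ModuleCat.{u} Cᵐᵒᵖ} (p : MinProjPres M)
    (q : MinProjPres (S.inflate M)) :
    ∃ (a : S.induced p.P₀ →ₗ[Bᵐᵒᵖ] q.P₀) (h : S.induced p.P₁ →ₗ[Bᵐᵒᵖ] q.P₁)
      (r : q.P₁ →ₗ[Bᵐᵒᵖ] S.induced p.P₁),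
      q.d₁ ∘ₗ h = a ∘ₗ S.inducedHom p.d₁ ∧ r ∘ₗ h = LinearMap.id := by
  have hA₀ := S.isProjectiveCover_coverHom p.cover₀
  let Ω := ModuleCat.of Cᵐᵒᵖ (LinearMap.ker p.d₀)
  let c₁ : p.P₁ →ₗ[Cᵐᵒᵖ] Ω :=
    p.d₁.codRestrict (LinearMap.ker p.d₀) fun x => LinearMap.mem_ker.2 (p.comp_eq_zero x)
  have hA₁ : IsProjectiveCover (S.coverHom c₁) := S.isProjectiveCover_coverHom p.cover₁
  have := hA₀.projective
  have := hA₁.projective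
  have := q.cover₁.projective
  obtain ⟨a, ha⟩ := Module.projective_lifting_property q.d₀ (S.coverHom p.d₀) q.cover₀.surjective
  -- Both `P₀ ⊗ B` and `Q₀` are projective covers of `M` over `B`.
  let a' := LinearEquiv.ofBijective a (hA₀.bijective_of_comp_eq q.cover₀ ha)
  have ha₀ : ∀ x, q.d₀ (a x) = S.coverHom p.d₀ x := LinearMap.congr_fun ha
  have hf : ∀ x, a (S.inducedHom p.d₁ x) ∈ LinearMap.ker q.d₀ := by
    intro x
    have h0 : p.d₀ ∘ₗ p.d₁ = 0 := LinearMap.ext p.comp_eq_zero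
    rw [LinearMap.mem_ker, ha₀, ← LinearMap.comp_apply, coverHom_comp_inducedHom, h0,
      coverHom_apply]
    rfl
  obtain ⟨h, hh⟩ := Module.projective_lifting_property _
    ((a ∘ₗ S.inducedHom p.d₁).codRestrict (LinearMap.ker q.d₀) hf) q.cover₁.surjective
  have hh' : q.d₁ ∘ₗ h = a ∘ₗ S.inducedHom p.d₁ :=
    LinearMap.ext fun x => congrArg Subtype.val (LinearMap.congr_fun hh x)
  have hg : ∀ x, p.d₀ (S.proj p.P₀ (a'.symm (q.d₁ x))) = 0 := by
    intro x
    refine (S.coverHom_apply p.d₀ _).symm.trans ?_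
    rw [← ha₀]
    exact (congrArg q.d₀ (a'.apply_symm_apply _)).trans (q.comp_eq_zero x)
  let g₀ : q.P₁ →ₗ[Bᵐᵒᵖ] S.inflate p.P₀ :=
    S.coverHom LinearMap.id ∘ₗ a'.symm.toLinearMap ∘ₗ q.d₁
  -- Going back along `Q₁ → Q₀ ≅ P₀ ⊗ B → P₀` lands in the syzygy `Ω` over `C`, and `g ∘ h` is the
  -- cover `P₁ ⊗ B → Ω`.
  let g : q.P₁ →ₗ[Bᵐᵒᵖ] S.inflate Ω :=
    { toFun := fun x => (⟨S.proj p.P₀ (a'.symm (q.d₁ x)), hg x⟩ : LinearMap.ker p.d₀)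
      map_add' := fun x y => Subtype.ext (g₀.map_add x y)
      map_smul' := fun b x => Subtype.ext (g₀.map_smul b x) }
  have hgh : g ∘ₗ h = S.coverHom c₁ := by
    refine S.induced_hom_ext fun n => Subtype.ext ?_
    have h1 : S.coverHom c₁ (S.incl _ n) = c₁ n := S.coverHom_incl c₁ n
    rw [h1]
    change S.proj p.P₀ (a'.symm ((q.d₁ ∘ₗ h) (S.incl _ n))) = p.d₁ n
    rw [hh', LinearMap.comp_apply, inducedHom_incl]
    exact (congrArg (S.proj p.P₀) (a'.symm_apply_apply _)).trans (S.proj_incl _)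
  obtain ⟨l, hl⟩ := Module.projective_lifting_property (S.coverHom c₁) g hA₁.surjective
  -- With `l` a lift of `g`, the endomorphism `l ∘ h` lies over the identity of `Ω`, hence is
  -- bijective; so `h` splits.
  let e := LinearEquiv.ofBijective (l ∘ₗ h) (hA₁.bijective_of_comp_eq hA₁ (by
    rw [← LinearMap.comp_assoc, hl, hgh]))
  exact ⟨a, h, e.symm.toLinearMap ∘ₗ l, hh', LinearMap.ext fun x => e.symm_apply_apply x⟩

/-- If `Hom_B(Y, D Tr M) = 0` then `Ext¹_B(M ⊗_C B, Y) = 0`. -/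
theorem subsingleton_ext_induced {M : ModuleCat.{u} Cᵐᵒᵖ} (p : MinProjPres M)
    (q : MinProjPres (S.inflate M)) {Y : ModuleCat.{u} Bᵐᵒᵖ} (hY : HomVanishes Y (q.dTr k)) :
    Subsingleton (Abelian.Ext (S.induced M) Y 1) := by
  have := p.cover₀.projective
  have := S.projective_induced p.P₀
  obtain ⟨a, h, r, hah, hr⟩ := S.exists_comparison p q
  have hker : LinearMap.ker p.d₀ ≤ LinearMap.range p.d₁ := fun x hx => by
    obtain ⟨y, hy⟩ := p.cover₁.surjective ⟨x, hx⟩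
    exact ⟨y, congrArg Subtype.val hy⟩
  have h0 : ∀ x, S.inducedHom p.d₁ x ∈ LinearMap.ker (S.inducedHom p.d₀) := by
    refine fun x => LinearMap.mem_ker.2 (LinearMap.congr_fun
      (f := S.inducedHom p.d₀ ∘ₗ S.inducedHom p.d₁) (g := 0) (S.induced_hom_ext fun n => ?_) x)
    rw [LinearMap.comp_apply, inducedHom_incl, inducedHom_incl, p.comp_eq_zero, map_zero]
    rfl
  refine subsingleton_ext_one_of_extends (S.inducedHom p.d₀)
    (S.inducedHom_surjective p.cover₀.surjective) Y fun u => ?_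
  let v : S.induced p.P₁ →ₗ[Bᵐᵒᵖ] Y := u ∘ₗ (S.inducedHom p.d₁).codRestrict _ h0
  -- Extend `v` to `Q₁` by the retraction `r`, factor through `Q₀`, and pull back along `a`; `r ∘ h
  -- = id` recovers `v`.
  obtain ⟨w, hw⟩ := q.exists_factor hY (v ∘ₗ r)
  have hv : (w ∘ₗ a) ∘ₗ S.inducedHom p.d₁ = v := by
    rw [LinearMap.comp_assoc, ← hah, ← LinearMap.comp_assoc, hw, LinearMap.comp_assoc, hr,
      LinearMap.comp_id]
  refine ⟨w ∘ₗ a, LinearMap.ext fun x => ?_⟩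
  obtain ⟨x, hx⟩ := x
  obtain ⟨y, rfl⟩ := S.ker_inducedHom_le hker p.cover₀.surjective hx
  exact LinearMap.congr_fun hv y

end SplitExtension

end

end TauRigid

theorem mainTheorem8 (k C B : Type u) [Field k] [IsAlgClosed k]
    [Ring C] [Algebra k C] [Module.Finite k C]
    [Ring B] [Algebra k B] [Module.Finite k B]
    (S : TauRigid.SplitExtension k C B)
    (M : ModuleCat.{u} Cᵐᵒᵖ) [Module.Finite Cᵐᵒᵖ M]
    (hC : TauRigid.IsTauRigid k M)
    (hB : TauRigid.IsTauRigid k (S.inflate M)) :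
    TauRigid.IsExtProjective (TauRigid.leftPerp (TauRigid.tau k (S.inflate M))) (S.induced M) ↔
      TauRigid.HomVanishes M (S.restrict (TauRigid.tau k (S.inflate M))) := by
  have := TauRigid.isArtinianRing_op k C
  obtain ⟨p⟩ := TauRigid.nonempty_minProjPres M
  rw [← S.homVanishes_induced_iff]
  exact ⟨fun h => h.1.2, fun h =>
    ⟨⟨inferInstance, h⟩, fun Y hY => S.subsingleton_ext_induced p _ hY.2⟩⟩
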